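/- Let $G$ be a finite simple connected graph with vertex set $V(G)$ and distance function $d_G$. Let $D(G)=(d_G(u,v))_{u,v\in V(G)}$ be its distance matrix, and let $\mathrm{Tr}(G)$ be the diagonal matrix whose entry at the vertex $u$ is the transmission $\sum_{v\in V(G)}d_G(u,v)$. Put $D^Q(G)=\mathrm{Tr}(G)+D(G)$ and, for $\alpha\in[0,1]$, $D_\alpha(G)=\alpha\,\mathrm{Tr}(G)+(1-\alpha)D(G)$. Denote by $\lambda_1(G)$, $\mu_1(G)$ and $\rho_\alpha(G)$ the largest eigenvalues of $D(G)$, $D^Q(G)$ and $D_\alpha(G)$, respectively. Let $\overline{G}$ denote the complement of $G$, and let $P_n$ and $K_{1,n-1}$ denote the path and the star on $n$ vertices. **Theorem.** Let $T$ be a tree of order $n\ge 4$ that is isomorphic neither to $K_{1,n-1}$ nor to $P_n$. (The complements $\overline{T}$ and $\overline{P_n}$ are then connected.) Then 1. $\lambda_1(\overline{T})>\lambda_1(\overline{P_n})$; 2. $\mu_1(\overline{T})>\mu_1(\overline{P_n})$; 3. $\rho_\alpha(\overline{T})>\rho_\alpha(\overline{P_n})$ for every $\alpha\in[0,1]$.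 -/

import Mathlib

/-- The distance matrix `D(G)`: its `(u, v)` entry is the graph distance between `u` and `v`. -/
noncomputable def SimpleGraph.distMatrix {V : Type*} (G : SimpleGraph V) : Matrix V V ℝ :=
  Matrix.of fun u v => (G.dist u v : ℝ)

/-- The transmission of a vertex: the sum of its distances to all vertices. -/
noncomputable def SimpleGraph.transmission {V : Type*} [Fintype V] (G : SimpleGraph V) (u : V) : ℝ :=
  ∑ v : V, (G.dist u v : ℝ)

/-- The diagonal matrix `Tr(G)` of the vertex transmissions. -/
noncomputable def SimpleGraph.transmissionMatrix {V : Type*} [Fintype V] [DecidableEq V]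
    (G : SimpleGraph V) : Matrix V V ℝ :=
  Matrix.diagonal G.transmission

/-- The distance signless Laplacian matrix `D^Q(G) = Tr(G) + D(G)`. -/
noncomputable def SimpleGraph.distSignlessLapMatrix {V : Type*} [Fintype V] [DecidableEq V]
    (G : SimpleGraph V) : Matrix V V ℝ :=
  G.transmissionMatrix + G.distMatrix

/-- The matrix `D_α(G) = α Tr(G) + (1 - α) D(G)`. -/
noncomputable def SimpleGraph.dAlphaMatrix {V : Type*} [Fintype V] [DecidableEq V]
    (G : SimpleGraph V) (α : ℝ) : Matrix V V ℝ :=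
  α • G.transmissionMatrix + (1 - α) • G.distMatrix

/-- The largest real eigenvalue of a square real matrix. For a symmetric matrix of positive size
the supremum is attained, see `Matrix.IsHermitian.isGreatest_largestEigenvalue`. -/
noncomputable def Matrix.largestEigenvalue {V : Type*} [Fintype V] [DecidableEq V]
    (M : Matrix V V ℝ) : ℝ :=
  sSup {t : ℝ | Module.End.HasEigenvalue (Matrix.toLin' M) t}

/-- The largest eigenvalue of a nonempty real symmetric matrix is indeed an eigenvalue, and an
upper bound of all the eigenvalues. -/
theorem Matrix.IsHermitian.isGreatest_largestEigenvalue {V : Type*} [Fintype V] [DecidableEq V]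
    [Nonempty V] {M : Matrix V V ℝ} (hM : M.IsHermitian) :
    IsGreatest {t : ℝ | Module.End.HasEigenvalue (Matrix.toLin' M) t} M.largestEigenvalue := by
  have hset : {t : ℝ | Module.End.HasEigenvalue (Matrix.toLin' M) t} = Set.range hM.eigenvalues := by
    rw [← hM.spectrum_real_eq_range_eigenvalues, ← Matrix.spectrum_toLin']
    ext t
    exact Module.End.hasEigenvalue_iff_mem_spectrum
  have hfin : {t : ℝ | Module.End.HasEigenvalue (Matrix.toLin' M) t}.Finite := by
    rw [hset]; exact Set.finite_range _
  have hne : {t : ℝ | Module.End.HasEigenvalue (Matrix.toLin' M) t}.Nonempty := by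
    rw [hset]; exact Set.range_nonempty _
  exact ⟨hne.csSup_mem hfin, fun t ht => le_csSup hfin.bddAbove ht⟩

/-- The distance spectral radius `λ₁(G)`: the largest eigenvalue of `D(G)`. -/
noncomputable def SimpleGraph.distSpectralRadius {V : Type*} [Fintype V] [DecidableEq V]
    (G : SimpleGraph V) : ℝ :=
  G.distMatrix.largestEigenvalue

/-- The distance signless Laplacian spectral radius `μ₁(G)`: the largest eigenvalue of
`D^Q(G)`. -/
noncomputable def SimpleGraph.distSignlessLapSpectralRadius {V : Type*} [Fintype V]
    [DecidableEq V] (G : SimpleGraph V) : ℝ :=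
  G.distSignlessLapMatrix.largestEigenvalue

/-- The `D_α`-spectral radius `ρ_α(G)`: the largest eigenvalue of `D_α(G)`. -/
noncomputable def SimpleGraph.dAlphaSpectralRadius {V : Type*} [Fintype V] [DecidableEq V]
    (G : SimpleGraph V) (α : ℝ) : ℝ :=
  (G.dAlphaMatrix α).largestEigenvalue

/-!
All three parts follow from the statement on `D_α`, since `D = D_0` and `D^Q = 2 D_{1/2}`.

Since `T` is not a star, no vertex of `T` is adjacent to all the others, and the complement is connected
(`IsAcyclic.connected_compl`). Therefore distances in it are at least `1` between distinct
vertices and at least `2` between vertices adjacent in `T`; for a path on at least five vertices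
these bounds are the exact distances. The quadratic form of `D_α` is
`∑ u, ∑ v, d(u, v) * w(x u, x v)` with `w(a, b) = α (a² + b²) / 2 + (1 - α) a b`, which is monotone in
nonnegative `a` and `b`. So, apart from a part common to all graphs on `n` vertices, the form of
the path is twice the sum of the weights `w` over its edges, and that of `T` is at least the like
expression for `T`.

*The path.* There is a dominant eigenvector that is nonnegative, symmetric and concave, so it
increases towards the middle (`exists_pathGraph_profile`). Numbering the vertices of the path by
`0, …, n - 1` from the middle outwards, alternating between the two sides, makes the entries
decrease, `y 0 ≥ y 1 ≥ …`, and makes the edges of the path the pairs `{k, k - 2}` for `k ≥ 2` together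
with `{1, 0}`; with truncated subtraction these are the pairs `{k, k - 2}`, `k ≠ 0`.

*The tree.* Every tree can be numbered so that each `k ≠ 0` is adjacent to some `p k ≤ k - 2`
(`IsTree.exists_numbering`). This is an induction that removes the two ends `a`, `b` of a diameter.
Unless the tree is a star these are leaves with different neighbours, so one of them is not attached
to the last vertex of the numbering of the rest; that one is appended first, the other one last.

Put the value `y k` at the vertex of `T` numbered `k`. Monotonicity gives
`w(y k, y (p k)) ≥ w(y k, y (k - 2))`, so the Rayleigh quotient of `T` is at least the largest eigenvalue
`ρ` of the path. If the largest eigenvalue of `T` were at most `ρ`, then `y` would be an eigenvector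
of `T` for `ρ`. But `T` is not a path, so there is a least `k` with `k` and `k - 2` not adjacent. The
vertex `p k` is then adjacent in `T` to all its neighbours in the path and to `k`, and the eigenvalue
equations of `T` and of the path at `p k` contradict each other. The case `n = 4`, where distances in
the complement of the path are larger, is void: each tree on four vertices is a star or a path.
-/

open SimpleGraph Matrix

/-! ### Largest eigenvalues of real symmetric matrices -/

theorem Matrix.IsHermitian.posSemidef_scalar_sub {V : Type*} [Fintype V] [DecidableEq V]
    {M : Matrix V V ℝ} (hM : M.IsHermitian) {t : ℝ} (ht : M.largestEigenvalue ≤ t) :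
    (t • (1 : Matrix V V ℝ) - M).PosSemidef := by
  have hH : (t • (1 : Matrix V V ℝ) - M).IsHermitian :=
    (Matrix.isHermitian_one.smul (IsSelfAdjoint.all t)).sub hM
  rw [hH.posSemidef_iff_eigenvalues_nonneg]
  intro i
  have : Nonempty V := ⟨i⟩
  have h := hH.mulVec_eigenvectorBasis i
  set e := hH.eigenvalues i
  set v : V → ℝ := ⇑(hH.eigenvectorBasis i) with hv
  have hv0 : v ≠ 0 := by
    intro h0
    apply hH.eigenvectorBasis.orthonormal.ne_zero i
    ext j
    exact congrFun h0 j
  have hev : Module.End.HasEigenvalue (Matrix.toLin' M) (t - e) := by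
    apply Module.End.hasEigenvalue_of_hasEigenvector (x := v)
    refine ⟨Module.End.mem_eigenspace_iff.2 ?_, hv0⟩
    rw [Matrix.toLin'_apply]
    rw [Matrix.sub_mulVec, Matrix.smul_mulVec, Matrix.one_mulVec] at h
    rw [sub_smul, ← h]
    simp
  have := hM.isGreatest_largestEigenvalue.2 hev
  show (0 : ℝ) ≤ e
  linarith

/-- A vector whose Rayleigh quotient reaches an upper bound of the spectrum is an eigenvector. -/
theorem Matrix.IsHermitian.mulVec_eq_of_largestEigenvalue_le {V : Type*} [Fintype V]
    [DecidableEq V] {M : Matrix V V ℝ} (hM : M.IsHermitian) {t : ℝ}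
    (ht : M.largestEigenvalue ≤ t) {x : V → ℝ} (hx : t * (x ⬝ᵥ x) ≤ x ⬝ᵥ (M *ᵥ x)) :
    M *ᵥ x = t • x := by
  have hP := hM.posSemidef_scalar_sub ht
  have hmul : (t • (1 : Matrix V V ℝ) - M) *ᵥ x = t • x - M *ᵥ x := by
    rw [Matrix.sub_mulVec, Matrix.smul_mulVec, Matrix.one_mulVec]
  have h0 : star x ⬝ᵥ ((t • (1 : Matrix V V ℝ) - M) *ᵥ x) = 0 := by
    refine le_antisymm ?_ (hP.dotProduct_mulVec_nonneg x)
    rw [hmul, star_trivial, dotProduct_sub, dotProduct_smul, smul_eq_mul]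
    linarith
  rw [hP.dotProduct_mulVec_zero_iff, hmul, sub_eq_zero] at h0
  exact h0.symm

/-- The part of the Perron–Frobenius theorem that needs no irreducibility: taking absolute values
of the entries of a dominant eigenvector does not decrease its Rayleigh quotient. -/
theorem Matrix.IsHermitian.exists_nonneg_eigenvector {V : Type*} [Fintype V] [DecidableEq V]
    [Nonempty V] {M : Matrix V V ℝ} (hM : M.IsHermitian) (hpos : ∀ i j, 0 ≤ M i j) :
    ∃ x : V → ℝ, (∀ i, 0 ≤ x i) ∧ x ≠ 0 ∧ M *ᵥ x = M.largestEigenvalue • x := by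
  obtain ⟨v, hv⟩ := hM.isGreatest_largestEigenvalue.1.exists_hasEigenvector
  have hv1 : M *ᵥ v = M.largestEigenvalue • v := by
    have := hv.apply_eq_smul
    rwa [Matrix.toLin'_apply] at this
  refine ⟨fun i => |v i|, fun i => abs_nonneg _, fun h => hv.2 ?_, ?_⟩
  · ext i
    simpa using congrFun h i
  · apply hM.mulVec_eq_of_largestEigenvalue_le le_rfl
    have h1 : M.largestEigenvalue * ((fun i => |v i|) ⬝ᵥ fun i => |v i|) = v ⬝ᵥ (M *ᵥ v) := by
      rw [hv1, dotProduct_smul, smul_eq_mul]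
      simp [dotProduct]
    rw [h1]
    simp only [dotProduct, mulVec, Finset.mul_sum]
    refine Finset.sum_le_sum fun i _ => Finset.sum_le_sum fun j _ => ?_
    calc v i * (M i j * v j) ≤ |v i * (M i j * v j)| := le_abs_self _
      _ = |v i| * (M i j * |v j|) := by rw [abs_mul, abs_mul, abs_of_nonneg (hpos i j)]

theorem Matrix.IsHermitian.largestEigenvalue_smul {V : Type*} [Fintype V] [DecidableEq V]
    [Nonempty V] {M : Matrix V V ℝ} (hM : M.IsHermitian) {c : ℝ} (hc : 0 < c) :
    (c • M).largestEigenvalue = c * M.largestEigenvalue := by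
  have hset : {t : ℝ | Module.End.HasEigenvalue (Matrix.toLin' (c • M)) t}
      = (c * ·) '' {t : ℝ | Module.End.HasEigenvalue (Matrix.toLin' M) t} := by
    ext t
    simp only [Set.mem_ofPred_eq, Set.mem_image, Module.End.hasEigenvalue_iff_mem_spectrum,
      Matrix.spectrum_toLin']
    rw [← Units.smul_mk0 hc.ne', spectrum.unit_smul_eq_smul, Set.mem_smul_set]
    simp [Units.smul_def]
  have h := hM.isGreatest_largestEigenvalue
  refine IsGreatest.csSup_eq ?_
  rw [hset]
  exact (monotone_mul_left_of_nonneg hc.le).map_isGreatest h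

/-! ### The matrices `D_α` and their quadratic forms -/

namespace SimpleGraph

section DAlpha

variable {V : Type*} [Fintype V] [DecidableEq V]

theorem dAlphaMatrix_isHermitian (G : SimpleGraph V) (α : ℝ) : (G.dAlphaMatrix α).IsHermitian := by
  ext i j
  by_cases h : i = j
  · subst h; simp
  · simp [dAlphaMatrix, transmissionMatrix, distMatrix, h, Ne.symm h,
      G.dist_comm]

theorem dAlphaMatrix_mulVec (G : SimpleGraph V) (α : ℝ) (x : V → ℝ) (u : V) :
    (G.dAlphaMatrix α *ᵥ x) u = ∑ v, (G.dist u v : ℝ) * (α * x u + (1 - α) * x v) := by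
  rw [dAlphaMatrix, add_mulVec, smul_mulVec, smul_mulVec, transmissionMatrix, Pi.add_apply,
    Pi.smul_apply, Pi.smul_apply, mulVec_diagonal]
  simp only [smul_eq_mul, transmission, mulVec, dotProduct, distMatrix, of_apply,
    Finset.sum_mul, Finset.mul_sum, ← Finset.sum_add_distrib]
  exact Finset.sum_congr rfl fun v _ => by ring

/-- The weight `α (a² + b²) / 2 + (1 - α) a b`: the quadratic form of `D_α` at `x` is the sum over all
pairs `(u, v)` of the distance times the weight of `x u` and `x v`. -/
noncomputable def pairWeight (α a b : ℝ) : ℝ := α * ((a ^ 2 + b ^ 2) / 2) + (1 - α) * (a * b)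

theorem dotProduct_dAlphaMatrix_mulVec (G : SimpleGraph V) (α : ℝ) (x : V → ℝ) :
    x ⬝ᵥ (G.dAlphaMatrix α *ᵥ x) = ∑ u, ∑ v, (G.dist u v : ℝ) * pairWeight α (x u) (x v) := by
  have h1 : x ⬝ᵥ (G.dAlphaMatrix α *ᵥ x)
      = ∑ u, ∑ v, (G.dist u v : ℝ) * (α * x u ^ 2 + (1 - α) * (x u * x v)) := by
    simp only [dotProduct, dAlphaMatrix_mulVec, Finset.mul_sum]
    exact Finset.sum_congr rfl fun u _ => Finset.sum_congr rfl fun v _ => by ring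
  have h2 : x ⬝ᵥ (G.dAlphaMatrix α *ᵥ x)
      = ∑ u, ∑ v, (G.dist u v : ℝ) * (α * x v ^ 2 + (1 - α) * (x u * x v)) := by
    rw [h1, Finset.sum_comm]
    refine Finset.sum_congr rfl fun u _ => Finset.sum_congr rfl fun v _ => ?_
    rw [G.dist_comm]; ring
  have h3 : ∑ u, ∑ v, (G.dist u v : ℝ) * pairWeight α (x u) (x v)
      = (∑ u, ∑ v, (G.dist u v : ℝ) * (α * x u ^ 2 + (1 - α) * (x u * x v))
        + ∑ u, ∑ v, (G.dist u v : ℝ) * (α * x v ^ 2 + (1 - α) * (x u * x v))) / 2 := by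
    rw [← Finset.sum_add_distrib, Finset.sum_div]
    refine Finset.sum_congr rfl fun u _ => ?_
    rw [← Finset.sum_add_distrib, Finset.sum_div]
    exact Finset.sum_congr rfl fun v _ => by rw [pairWeight]; ring
  rw [h3, ← h1, ← h2]; ring

theorem pairWeight_nonneg {α a b : ℝ} (h0 : 0 ≤ α) (h1 : α ≤ 1) (ha : 0 ≤ a) (hb : 0 ≤ b) :
    0 ≤ pairWeight α a b := by
  have : 0 ≤ 1 - α := by linarith
  unfold pairWeight; positivity

theorem pairWeight_le_pairWeight {α a b c : ℝ} (h0 : 0 ≤ α) (h1 : α ≤ 1) (ha : 0 ≤ a)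
    (hb : 0 ≤ b) (hbc : b ≤ c) : pairWeight α a b ≤ pairWeight α a c := by
  have : 0 ≤ 1 - α := by linarith
  unfold pairWeight; gcongr

theorem distSpectralRadius_eq_dAlphaSpectralRadius (G : SimpleGraph V) :
    G.distSpectralRadius = G.dAlphaSpectralRadius 0 := by
  simp [distSpectralRadius, dAlphaSpectralRadius, dAlphaMatrix]

theorem distSignlessLapSpectralRadius_eq [Nonempty V] (G : SimpleGraph V) :
    G.distSignlessLapSpectralRadius = 2 * G.dAlphaSpectralRadius (1 / 2) := by
  rw [dAlphaSpectralRadius, ← (G.dAlphaMatrix_isHermitian _).largestEigenvalue_smul two_pos,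
    distSignlessLapSpectralRadius, distSignlessLapMatrix, dAlphaMatrix, smul_add, smul_smul,
    smul_smul]
  norm_num

end DAlpha


/-! ### Distances in the complement -/

theorem compl_dist_eq_two {V : Type*} {G : SimpleGraph V} {u v w : V} (h : G.Adj u v)
    (hwu : w ≠ u) (hwv : w ≠ v) (hu : ¬ G.Adj u w) (hv : ¬ G.Adj w v) : Gᶜ.dist u v = 2 := by
  have h1 : Gᶜ.Adj u w := ⟨hwu.symm, hu⟩
  have h2 : Gᶜ.Adj w v := ⟨hwv, hv⟩
  refine le_antisymm (dist_le (h1.toWalk.append h2.toWalk)) ?_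
  exact (h1.reachable.trans h2.reachable).one_lt_dist_of_ne_of_not_adj h.ne fun h' => h'.2 h

/-- In a connected complement, distinct vertices have distance at least `1`, and vertices adjacent in
the graph itself have distance at least `2`. -/
theorem le_compl_dist {V : Type*} [DecidableEq V] {G : SimpleGraph V} [DecidableRel G.Adj]
    (hG : Gᶜ.Connected) (u v : V) :
    (if u = v then 0 else 1) + (if G.Adj u v then 1 else 0) ≤ Gᶜ.dist u v := by
  by_cases huv : u = v
  · subst huv; simp
  · have h1 := hG.pos_dist_of_ne huv
    by_cases h : G.Adj u v
    · have := hG.one_lt_dist_of_ne_of_not_adj huv fun h' => h'.2 h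
      simp [huv, h]; omega
    · simp [huv, h]; omega

theorem IsAcyclic.not_triangle {V : Type*} {T : SimpleGraph V} (hT : T.IsAcyclic) {a b c : V}
    (hab : T.Adj a b) (hbc : T.Adj b c) : ¬ T.Adj a c := by
  intro hac
  have h1 : (Walk.cons hab (Walk.cons hbc Walk.nil)).IsPath := by
    simp [hab.ne, hbc.ne, hac.ne]
  have h2 := hT.eq_snd_of_adj_start h1 hac (by simp)
  simp at h2
  exact hbc.ne h2.symm

theorem IsAcyclic.not_square {V : Type*} {T : SimpleGraph V} (hT : T.IsAcyclic) {a b c d : V}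
    (hab : T.Adj a b) (hbc : T.Adj b c) (hcd : T.Adj c d) (hac : a ≠ c) (hbd : b ≠ d) :
    ¬ T.Adj a d := by
  intro had
  have h1 : (Walk.cons hab (Walk.cons hbc (Walk.cons hcd Walk.nil))).IsPath := by
    simp [hab.ne, hbc.ne, hcd.ne, hac, hbd, had.ne]
  have h2 := hT.eq_snd_of_adj_start h1 had (by simp)
  simp at h2
  exact hbd h2.symm

/-- The complement of an acyclic graph without a dominating vertex is connected: the ends `u`, `v` of
an edge are joined in the complement through a non-neighbour of `u` and a non-neighbour of `v`. -/
theorem IsAcyclic.connected_compl {V : Type*} [Nonempty V] {T : SimpleGraph V}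
    (hT : T.IsAcyclic) (hs : ∀ c, ∃ w, w ≠ c ∧ ¬ T.Adj c w) : Tᶜ.Connected := by
  refine ⟨fun u v => ?_⟩
  by_cases huv : u = v
  · subst huv; exact Reachable.refl _
  by_cases h : T.Adj u v
  · obtain ⟨a, hav, hva⟩ := hs v
    obtain ⟨b, hbu, hub⟩ := hs u
    have hau : a ≠ u := by rintro rfl; exact hva h.symm
    have hbv : b ≠ v := by rintro rfl; exact hub h
    have h1 : Tᶜ.Adj u b := ⟨hbu.symm, hub⟩
    have h2 : Tᶜ.Adj a v := ⟨hav, fun h' => hva h'.symm⟩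
    by_cases hab : a = b
    · subst hab; exact h1.reachable.trans h2.reachable
    by_cases hT1 : T.Adj u a
    · by_cases hT2 : T.Adj b v
      · -- `u`, `v`, `b`, `a` would be a four-cycle if `a` and `b` were adjacent
        have h3 : Tᶜ.Adj b a := ⟨Ne.symm hab, fun h' =>
          hT.not_square h hT2.symm h' hbu.symm hav.symm hT1⟩
        exact h1.reachable.trans (h3.reachable.trans h2.reachable)
      · exact h1.reachable.trans (Adj.reachable (G := Tᶜ) ⟨hbv, hT2⟩)
    · exact (Adj.reachable (G := Tᶜ) ⟨hau.symm, hT1⟩).trans h2.reachable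
  · exact Adj.reachable (G := Tᶜ) ⟨huv, h⟩

/-- An acyclic graph with a dominating vertex is a star. -/
theorem IsAcyclic.nonempty_iso_star {V : Type*} [Fintype V] [DecidableEq V] {T : SimpleGraph V}
    (hT : T.IsAcyclic) {n : ℕ} (hV : Fintype.card V = n) {c : V}
    (hc : ∀ w, w ≠ c → T.Adj c w) :
    Nonempty (T ≃g completeBipartiteGraph (Fin 1) (Fin (n - 1))) := by
  have hadj : ∀ u v, T.Adj u v ↔ u ≠ v ∧ (u = c ∨ v = c) := by
    intro u v
    constructor
    · intro h
      refine ⟨h.ne, ?_⟩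
      by_contra! hne
      exact hT.not_triangle (hc u hne.1) h (hc v hne.2)
    · rintro ⟨hne, rfl | rfl⟩
      · exact hc v hne.symm
      · exact (hc u hne).symm
  have e1 : {v : V // v = c} ≃ Fin 1 := Fintype.equivFinOfCardEq (by simp)
  have e2 : {v : V // ¬ v = c} ≃ Fin (n - 1) := Fintype.equivFinOfCardEq (by
    rw [Fintype.card_subtype_compl, hV]; simp)
  refine ⟨⟨(Equiv.sumCompl (· = c)).symm.trans (e1.sumCongr e2), ?_⟩⟩
  intro u v
  rw [hadj]
  by_cases hu : u = c <;> by_cases hv : v = c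
  · subst hu; subst hv; simp [completeBipartiteGraph]
  all_goals simp [completeBipartiteGraph, hu, hv, Equiv.sumCompl_symm_apply_of_pos,
    Equiv.sumCompl_symm_apply_of_neg]
  all_goals try (rintro rfl; contradiction)

/-! ### Numbering the vertices of a tree -/

/-- A vertex at maximal distance from `b` in a tree is a leaf. -/
theorem IsTree.eq_of_adj_of_forall_dist_le {V : Type*} {T : SimpleGraph V} (hT : T.IsTree)
    {a b c d : V} (hmax : ∀ w, T.dist b w ≤ T.dist b a) (hc : T.Adj a c) (hd : T.Adj a d) :
    c = d := by
  have key : ∀ x, T.Adj a x → ∃ p : T.Walk b a, p.IsPath ∧ p.penultimate = x := by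
    intro x hx
    have hdist : T.dist b a = T.dist b x + 1 := by
      rcases hT.dist_eq_dist_add_one_of_adj b hx with h | h
      · exact h
      · have := hmax x; omega
    obtain ⟨p, -, hp⟩ := hT.connected.exists_path_of_dist b x
    refine ⟨p.concat hx.symm, Walk.isPath_of_length_eq_dist _ ?_, by simp⟩
    rw [Walk.length_concat, hp, hdist]
  obtain ⟨p, hp, hpc⟩ := key c hc
  obtain ⟨q, hq, hqd⟩ := key d hd
  rw [← hpc, ← hqd, (hT.existsUnique_path b a).unique hp hq]

/-- Deleting two leaves `a` and `b` of a tree leaves a tree if it has a further vertex, here the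
neighbour `a'` of `a`. -/
theorem IsTree.induce_of_leaves {V : Type*} {T : SimpleGraph V} (hT : T.IsTree)
    {a b a' b' : V} (ha : ∀ c, T.Adj a c → c = a') (hb : ∀ c, T.Adj b c → c = b')
    (ha'a : a' ≠ a) (ha'b : a' ≠ b) :
    (T.induce {x | x ≠ a ∧ x ≠ b}).IsTree := by
  refine ⟨?_, hT.isAcyclic.induce _⟩
  have key : ∀ m, ∀ w : {x | x ≠ a ∧ x ≠ b}, T.dist a' w = m →
      (T.induce {x | x ≠ a ∧ x ≠ b}).Reachable ⟨a', ha'a, ha'b⟩ w := by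
    intro m
    induction m using Nat.strong_induction_on with
    | _ m ih =>
      rintro ⟨w, hwa, hwb⟩ hw
      by_cases hwa' : w = a'
      · subst hwa'; exact Reachable.refl _
      obtain ⟨p, hp⟩ := hT.connected.exists_walk_length_eq_dist a' w
      have hpos := hT.connected.pos_dist_of_ne (Ne.symm hwa')
      have hnil : ¬ p.Nil := by
        intro hn; exact hwa' hn.eq.symm
      have hadj := p.adj_penultimate hnil
      set x := p.penultimate
      have hx : T.dist a' x < T.dist a' w := by
        have h1 := dist_le p.dropLast
        rw [Walk.length_dropLast] at h1
        have : T.dist a' x ≤ p.length - 1 := h1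
        omega
      have hxa : x ≠ a := by
        intro h; exact hwa' (ha w (h ▸ hadj))
      have hxb : x ≠ b := by
        intro h
        have h1 := hb w (h ▸ hadj)
        rw [h, h1] at hx
        -- `b` is reached only through `b'`
        obtain ⟨q, hq⟩ := hT.connected.exists_walk_length_eq_dist a' b
        have hqn : ¬ q.Nil := by
          intro hn; exact ha'b hn.eq
        have h2 := hb _ (q.adj_penultimate hqn).symm
        have h3 := dist_le q.dropLast
        rw [Walk.length_dropLast, h2] at h3
        omega
      have h1 := ih _ (hw ▸ hx) ⟨x, hxa, hxb⟩ rfl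
      have h2 : (T.induce {x | x ≠ a ∧ x ≠ b}).Adj ⟨x, hxa, hxb⟩ ⟨w, hwa, hwb⟩ := hadj
      exact h1.trans h2.reachable
  have : Nonempty {x | x ≠ a ∧ x ≠ b} := ⟨⟨a', ha'a, ha'b⟩⟩
  exact ⟨fun u v => (key _ u rfl).symm.trans (key _ v rfl)⟩


/-- In a tree of diameter at most two some vertex dominates all the others. -/
theorem IsTree.exists_dominating_of_dist_le_two {V : Type*} {T : SimpleGraph V} (hT : T.IsTree)
    {a b : V} (hmax : ∀ v w, T.dist v w ≤ T.dist a b) (h2 : T.dist a b ≤ 2) :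
    ∃ c, ∀ w, w ≠ c → T.Adj c w := by
  by_cases hab : a = b
  · subst hab
    refine ⟨a, fun w hw => ?_⟩
    have h1 := hmax w a
    rw [dist_self] at h1
    exact absurd (hT.connected.dist_eq_zero_iff.1 (Nat.le_zero.1 h1)) hw
  have hleaf : ∀ {c d}, T.Adj a c → T.Adj a d → c = d :=
    hT.eq_of_adj_of_forall_dist_le (b := b) fun w => by
      rw [T.dist_comm (u := b) (v := a)]; exact hmax b w
  obtain ⟨p, -⟩ := hT.connected.exists_walk_length_eq_dist a b
  have hc := p.adj_snd fun hn => hab hn.eq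
  refine ⟨p.snd, fun w hw => ?_⟩
  by_cases hwa : w = a
  · subst hwa; exact hc.symm
  -- a shortest walk from the leaf `a` to `w` passes through the only neighbour of `a`
  obtain ⟨q, hq⟩ := hT.connected.exists_walk_length_eq_dist a w
  have hqn : ¬ q.Nil := fun hn => hwa hn.eq.symm
  have h3 : T.dist p.snd w ≤ q.tail.length := hleaf (q.adj_snd hqn) hc ▸ dist_le q.tail
  have h4 := q.length_tail_add_one hqn
  have h5 := hmax a w
  have h6 := hT.connected.pos_dist_of_ne hw.symm
  exact dist_eq_one_iff_adj.1 (by omega)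

/-- The vertices of a tree on `n` vertices can be numbered by `0, …, n - 1` so that each vertex
`k ≠ 0` has a neighbour with a number at most `k - 2` (truncated subtraction). -/
theorem IsTree.exists_numbering (n : ℕ) : ∀ {V : Type*} [Fintype V] {T : SimpleGraph V},
    T.IsTree → Fintype.card V = n → ∃ ℓ : ℕ → V, (∀ v, ∃ k < n, ℓ k = v) ∧
      ∀ k, 0 < k → k < n → ∃ j ≤ k - 2, T.Adj (ℓ k) (ℓ j) := by
  induction n using Nat.strong_induction_on with
  | _ n ih =>
  intro V _ T hT hV
  classical
  have hne : Nonempty V := hT.connected.nonempty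
  by_cases hstar : ∃ c, ∀ w, w ≠ c → T.Adj c w
  · obtain ⟨c, hc⟩ := hstar
    have hn : 0 < n := hV ▸ Fintype.card_pos
    let e := (Fintype.equivFinOfCardEq hV).symm
    let e' := e.trans (Equiv.swap (e ⟨0, hn⟩) c)
    have he' : e' ⟨0, hn⟩ = c := by simp [e']
    refine ⟨fun k => if h : k < n then e' ⟨k, h⟩ else c, fun v => ?_, fun k hk0 hk => ?_⟩
    · refine ⟨e'.symm v, (e'.symm v).2, ?_⟩
      simp
    · refine ⟨0, Nat.zero_le _, ?_⟩
      simp only [hk, hn, dif_pos, he']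
      refine (hc _ fun h => ?_).symm
      rw [← he'] at h
      have := congrArg Fin.val (e'.injective h)
      simp at this
      omega
  obtain ⟨⟨a, b⟩, hmax⟩ := Finite.exists_max fun p : V × V => T.dist p.1 p.2
  replace hmax : ∀ v w, T.dist v w ≤ T.dist a b := fun v w => hmax (v, w)
  have h3 : 3 ≤ T.dist a b := by
    by_contra h
    exact hstar (hT.exists_dominating_of_dist_le_two hmax (by omega))
  have hab : a ≠ b := by rintro rfl; simp at h3
  obtain ⟨p, -⟩ := hT.connected.exists_walk_length_eq_dist a b
  have hpn : ¬ p.Nil := fun hn => hab hn.eq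
  obtain ⟨a', haa'⟩ : ∃ a', T.Adj a a' := ⟨_, p.adj_snd hpn⟩
  obtain ⟨b', hbb'⟩ : ∃ b', T.Adj b b' := ⟨_, (p.adj_penultimate hpn).symm⟩
  have ha : ∀ c, T.Adj a c → c = a' := fun c hc =>
    hT.eq_of_adj_of_forall_dist_le (b := b)
      (fun w => by rw [T.dist_comm (u := b) (v := a)]; exact hmax b w) hc haa'
  have hb : ∀ c, T.Adj b c → c = b' := fun c hc =>
    hT.eq_of_adj_of_forall_dist_le (b := a) (fun w => hmax a w) hc hbb'
  have hab' : ¬ T.Adj a b := fun h => by rw [dist_eq_one_iff_adj.2 h] at h3; omega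
  have ha'b' : a' ≠ b' := by
    rintro rfl
    have := dist_le (haa'.toWalk.append hbb'.symm.toWalk)
    simp at this
    omega
  have ha'b : a' ≠ b := by rintro rfl; exact hab' haa'
  have hb'a : b' ≠ a := by rintro rfl; exact hab' hbb'.symm
  have hT' := hT.induce_of_leaves ha hb haa'.ne' ha'b
  have hcard : Fintype.card {x | x ≠ a ∧ x ≠ b} = n - 2 := by
    have h1 : ({x | x ≠ a ∧ x ≠ b} : Set V).toFinset = ({a, b} : Finset V)ᶜ := by
      ext x; simp
    rw [← Set.toFinset_card, h1, Finset.card_compl, Finset.card_pair hab, hV]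
  have hn2 : 2 ≤ n := by
    rw [← hV, ← Finset.card_pair hab]; exact Finset.card_le_univ _
  obtain ⟨ℓ, hsurj, hpar⟩ := ih (n - 2) (by omega) hT' hcard
  -- the two deleted leaves are numbered last; the first of them must not hang at vertex `n - 3`
  have extend : ∀ x y x' y' : V, T.Adj x x' → T.Adj y y' → (∀ v, v ≠ x → v ≠ y → v ≠ a ∧ v ≠ b) →
      (hx' : x' ≠ a ∧ x' ≠ b) → (hy' : y' ≠ a ∧ y' ≠ b) → x' ≠ ℓ (n - 3) →
      ∃ ℓ : ℕ → V, (∀ v, ∃ k < n, ℓ k = v) ∧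
        ∀ k, 0 < k → k < n → ∃ j ≤ k - 2, T.Adj (ℓ k) (ℓ j) := by
    intro x y x' y' hx hy hxy hx' hy' hlast
    refine ⟨fun k => if k < n - 2 then (ℓ k : V) else if k = n - 2 then x else y, ?_, ?_⟩
    · intro v
      by_cases hvx : v = x
      · exact ⟨n - 2, by omega, by simp [hvx]⟩
      by_cases hvy : v = y
      · refine ⟨n - 1, by omega, ?_⟩
        simp only [show ¬ n - 1 < n - 2 by omega, show n - 1 ≠ n - 2 by omega, if_false, hvy]
      obtain ⟨k, hk, hkv⟩ := hsurj ⟨v, hxy v hvx hvy⟩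
      exact ⟨k, by omega, by simp [hk, hkv]⟩
    · intro k hk0 hk
      rcases lt_trichotomy k (n - 2) with h | h | h
      · obtain ⟨j, hj, hadj⟩ := hpar k hk0 h
        refine ⟨j, hj, ?_⟩
        simp only [h, show j < n - 2 by omega, if_true]
        exact hadj
      · obtain ⟨j, hj, hjx⟩ := hsurj ⟨x', hx'⟩
        have hjx' : (ℓ j : V) = x' := by rw [hjx]
        have : j ≠ n - 3 := by rintro rfl; exact hlast hjx'.symm
        refine ⟨j, by omega, ?_⟩
        simpa [h, hj, hjx'] using hx
      · obtain ⟨j, hj, hjy⟩ := hsurj ⟨y', hy'⟩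
        have hjy' : (ℓ j : V) = y' := by rw [hjy]
        refine ⟨j, by omega, ?_⟩
        simpa [show ¬ k < n - 2 by omega, h.ne', hj, hjy'] using hy
  by_cases hlast : a' = ℓ (n - 3)
  · refine extend b a b' a' hbb' haa' (fun v h h' => ⟨h', h⟩) ⟨hb'a, hbb'.ne'⟩
      ⟨haa'.ne', ha'b⟩ fun h => ha'b' (hlast.trans h.symm)
  · exact extend a b a' b' haa' hbb' (fun v h h' => ⟨h, h'⟩) ⟨haa'.ne', ha'b⟩
      ⟨hb'a, hbb'.ne'⟩ hlast


/-! ### The complement of the path and its dominant eigenvector -/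

theorem pathGraph_compl_dist {n : ℕ} (hn : 5 ≤ n) (i j : Fin n) :
    (pathGraph n)ᶜ.dist i j = (if i = j then 0 else 1) +
      (if (i : ℕ) + 1 = j ∨ (j : ℕ) + 1 = i then 1 else 0) := by
  by_cases hij : i = j
  · subst hij; simp
  by_cases h : (i : ℕ) + 1 = j ∨ (j : ℕ) + 1 = i
  · rw [if_neg hij, if_pos h]
    -- a vertex at distance more than one from the edge `ij`
    obtain ⟨w, hw⟩ : ∃ w : Fin n, ((w : ℕ) + 1 < i ∧ (w : ℕ) + 1 < j) ∨
        ((i : ℕ) + 1 < w ∧ (j : ℕ) + 1 < w) := by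
      by_cases h2 : 2 ≤ (i : ℕ) ∧ 2 ≤ (j : ℕ)
      · exact ⟨⟨0, by omega⟩, Or.inl (by simp; omega)⟩
      · exact ⟨⟨4, by omega⟩, Or.inr (by simp; omega)⟩
    refine compl_dist_eq_two (w := w) (pathGraph_adj.2 h) ?_ ?_ ?_ ?_
    · rintro rfl; omega
    · rintro rfl; omega
    · rw [pathGraph_adj]; omega
    · rw [pathGraph_adj]; omega
  · rw [if_neg hij, if_neg h]
    exact dist_eq_one_iff_adj.2 ⟨hij, fun h' => h (pathGraph_adj.1 h')⟩

theorem pathGraph_compl_dist_rev {n : ℕ} (hn : 5 ≤ n) (i j : Fin n) :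
    (pathGraph n)ᶜ.dist i.rev j.rev = (pathGraph n)ᶜ.dist i j := by
  rw [pathGraph_compl_dist hn, pathGraph_compl_dist hn]
  simp only [Fin.rev_inj, Fin.val_rev]
  congr 1
  refine if_congr ?_ rfl rfl
  omega

/-- The sum of the values of `F` at the neighbours of `i` in the path. -/
noncomputable def pathNbrSum {n : ℕ} (F : Fin n → ℝ) (i : Fin n) : ℝ :=
  (if h : (i : ℕ) + 1 < n then F ⟨i + 1, h⟩ else 0) +
    (if 0 < (i : ℕ) then F ⟨i - 1, by omega⟩ else 0)

theorem sum_pathGraph_compl_dist_mul {n : ℕ} (hn : 5 ≤ n) (F : Fin n → ℝ) (i : Fin n) :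
    ∑ j, ((pathGraph n)ᶜ.dist i j : ℝ) * F j = ∑ j, F j - F i + pathNbrSum F i := by
  have h1 : ∀ j, ((pathGraph n)ᶜ.dist i j : ℝ) * F j = F j - (if i = j then F j else 0)
      + ((if (i : ℕ) + 1 = j then F j else 0) + (if (j : ℕ) + 1 = i then F j else 0)) := by
    intro j
    rw [pathGraph_compl_dist hn]
    by_cases hij : i = j
    · subst hij; simp
    · by_cases h2 : (i : ℕ) + 1 = j
      · have h3 : ¬ (j : ℕ) + 1 = i := by omega
        simp only [hij, h2, h3, if_true, if_false, true_or]; push_cast; ring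
      · by_cases h3 : (j : ℕ) + 1 = i <;> simp [hij, h2, h3]; ring
  rw [Finset.sum_congr rfl fun j _ => h1 j, Finset.sum_add_distrib, Finset.sum_sub_distrib,
    Finset.sum_add_distrib, Finset.sum_ite_eq, if_pos (Finset.mem_univ _), pathNbrSum]
  congr 2
  · split_ifs with h
    · rw [Finset.sum_eq_single (⟨i + 1, h⟩ : Fin n)]
      · simp
      · intro b _ hb
        rw [if_neg]
        intro h'; exact hb (Fin.ext h'.symm)
      · simp
    · refine Finset.sum_eq_zero fun j _ => if_neg ?_
      omega
  · split_ifs with h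
    · rw [Finset.sum_eq_single (⟨i - 1, by omega⟩ : Fin n)]
      · rw [if_pos]; simp; omega
      · intro b _ hb
        rw [if_neg]
        intro h'; exact hb (Fin.ext (by simp; omega))
      · simp
    · refine Finset.sum_eq_zero fun j _ => if_neg ?_
      omega

theorem pathNbrSum_nonneg {n : ℕ} {F : Fin n → ℝ} (hF : ∀ i, 0 ≤ F i) (i : Fin n) :
    0 ≤ pathNbrSum F i := by
  unfold pathNbrSum
  refine add_nonneg ?_ ?_ <;> split_ifs <;> simp [hF]

theorem pathNbrSum_one_le_two {n : ℕ} (i : Fin n) : pathNbrSum (fun _ => 1) i ≤ 2 := by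
  unfold pathNbrSum
  split_ifs <;> norm_num

theorem pathNbrSum_le_mul {n : ℕ} {F : Fin n → ℝ} {m : ℝ} (hF : ∀ i, F i ≤ m)
    (i : Fin n) : pathNbrSum F i ≤ pathNbrSum (fun _ => 1) i * m := by
  unfold pathNbrSum
  rw [add_mul]
  refine add_le_add ?_ ?_ <;> split_ifs <;> simp [hF]

/-- The rows of `D_α` of the complement of the path. Here `pathNbrSum (fun _ => 1) i` is the degree of
`i` in the path. -/
theorem pathGraph_compl_dAlphaMatrix_mulVec {n : ℕ} (hn : 5 ≤ n) (α : ℝ) (x : Fin n → ℝ)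
    (i : Fin n) : ((pathGraph n)ᶜ.dAlphaMatrix α *ᵥ x) i
      = α * (n - 1 + pathNbrSum (fun _ => 1) i) * x i
        + (1 - α) * (∑ j, x j - x i + pathNbrSum x i) := by
  have h1 := sum_pathGraph_compl_dist_mul hn (fun _ => 1) i
  rw [dAlphaMatrix_mulVec, ← sum_pathGraph_compl_dist_mul hn x i]
  have h2 : (n : ℝ) - 1 + pathNbrSum (fun _ => 1) i
      = ∑ j, ((pathGraph n)ᶜ.dist i j : ℝ) * 1 := by
    rw [h1]; simp
  rw [h2, Finset.mul_sum, Finset.sum_mul, Finset.mul_sum, ← Finset.sum_add_distrib]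
  exact Finset.sum_congr rfl fun j _ => by ring

theorem pathGraph_compl_dAlphaMatrix_mulVec_rev {n : ℕ} (hn : 5 ≤ n) (α : ℝ) (x : Fin n → ℝ)
    (i : Fin n) : ((pathGraph n)ᶜ.dAlphaMatrix α *ᵥ (fun j => x j.rev)) i
      = ((pathGraph n)ᶜ.dAlphaMatrix α *ᵥ x) i.rev := by
  rw [dAlphaMatrix_mulVec, dAlphaMatrix_mulVec, ← Equiv.sum_comp Fin.revPerm]
  refine Finset.sum_congr rfl fun j _ => ?_
  rw [← pathGraph_compl_dist_rev hn]
  simp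

/-- A nonnegative eigenvector is concave along the path. The equation at a maximal entry `m` gives
`κ * m ≤ (1 - α) * ∑ j, x j` for the `κ` below, so that this holds at every entry, and at an
interior vertex the eigenvalue equation turns it into concavity. -/
theorem pathGraph_eigenvector_concave {n : ℕ} (hn : 5 ≤ n) {α t : ℝ} (h1 : α < 1)
    {x : Fin n → ℝ} (hx : ∀ i, 0 ≤ x i) (hev : (pathGraph n)ᶜ.dAlphaMatrix α *ᵥ x = t • x)
    (i : Fin n) (hi0 : 0 < (i : ℕ)) (hi : (i : ℕ) + 1 < n) :
    x ⟨i - 1, by omega⟩ + x ⟨i + 1, hi⟩ ≤ 2 * x i := by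
  have heq : ∀ i, t * x i = α * (n - 1 + pathNbrSum (fun _ => 1) i) * x i
        + (1 - α) * (∑ j, x j - x i + pathNbrSum x i) := by
    intro i
    rw [← pathGraph_compl_dAlphaMatrix_mulVec hn, hev]; simp
  have : Nonempty (Fin n) := ⟨i⟩
  obtain ⟨i₀, hmax⟩ := Finite.exists_max x
  set S := ∑ j, x j
  have hS : 0 ≤ S := Finset.sum_nonneg fun j _ => hx j
  set κ := t - α * (n - 1) + (1 - α) - 2 with hκ
  have hm : κ * x i₀ ≤ (1 - α) * S := by
    have h2 := heq i₀
    have h3 : (1 - α) * pathNbrSum x i₀ ≤ (1 - α) * (pathNbrSum (fun _ => 1) i₀ * x i₀) :=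
      mul_le_mul_of_nonneg_left (pathNbrSum_le_mul hmax i₀) (by linarith)
    have h4 : pathNbrSum (fun _ => 1) i₀ * x i₀ ≤ 2 * x i₀ :=
      mul_le_mul_of_nonneg_right (pathNbrSum_one_le_two i₀) (hx i₀)
    rw [hκ]
    linear_combination h2 + h3 + h4
  have hi' : κ * x i ≤ (1 - α) * S := by
    rcases le_total 0 κ with h | h
    · exact (mul_le_mul_of_nonneg_left (hmax i) h).trans hm
    · exact (mul_nonpos_of_nonpos_of_nonneg h (hx i)).trans
        (mul_nonneg (by linarith) hS)
  have h5 := heq i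
  simp only [pathNbrSum, hi, hi0, dif_pos, if_true] at h5
  have h6 : (1 - α) * (x ⟨i - 1, by omega⟩ + x ⟨i + 1, hi⟩) ≤ (1 - α) * (2 * x i) := by
    rw [hκ] at hi'
    linear_combination hi' - h5
  exact le_of_mul_le_mul_left h6 (by linarith)

/-- A symmetric concave sequence increases on the first half of its range. -/
theorem le_succ_of_concave_of_symm {n : ℕ} {X : ℕ → ℝ} (hsymm : ∀ k < n, X (n - 1 - k) = X k)
    (hconc : ∀ k, 0 < k → k + 1 < n → X (k - 1) + X (k + 1) ≤ 2 * X k) {k : ℕ}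
    (hk : 2 * k + 2 ≤ n) : X k ≤ X (k + 1) := by
  have hanti : ∀ j, k + j + 2 ≤ n → X (k + j + 1) - X (k + j) ≤ X (k + 1) - X k := by
    intro j
    induction j with
    | zero => intro; simp
    | succ j ih =>
      intro hj
      have h1 := ih (by omega)
      have h2 := hconc (k + j + 1) (by omega) (by omega)
      rw [show k + j + 1 - 1 = k + j by omega] at h2
      rw [show k + (j + 1) = k + j + 1 by omega]
      linarith
  -- the mirror image of the step from `k` to `k + 1`
  have h1 := hanti (n - 2 - 2 * k) (by omega)
  have h2 := hsymm k (by omega)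
  have h3 := hsymm (k + 1) (by omega)
  rw [show k + (n - 2 - 2 * k) + 1 = n - 1 - k by omega,
    show k + (n - 2 - 2 * k) = n - 1 - (k + 1) by omega, h2, h3] at h1
  linarith

/-- A dominant eigenvector `X 0, …, X (n - 1)` of `D_α` of the complement of the path that is
nonnegative, symmetric, and increases towards the middle of the path. For `α < 1` it is positive;
for `α = 1` it vanishes at the two ends, and the last inequality is what the two cases share. -/
theorem exists_pathGraph_profile {n : ℕ} (hn : 5 ≤ n) {α : ℝ} (h0 : 0 ≤ α) (h1 : α ≤ 1) :
    ∃ (X : ℕ → ℝ) (t : ℝ), (pathGraph n)ᶜ.dAlphaSpectralRadius α ≤ t ∧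
      (pathGraph n)ᶜ.dAlphaMatrix α *ᵥ (fun i : Fin n => X i) = t • (fun i : Fin n => X i) ∧
      (∀ k < n, 0 ≤ X k) ∧ (∀ k < n, X (n - 1 - k) = X k) ∧
      (∀ k, 2 * k + 2 ≤ n → X k ≤ X (k + 1)) ∧
      (∀ i k, 0 < i → i + 1 < n → k < n → 0 < α * X i + (1 - α) * X k) := by
  have hne : Nonempty (Fin n) := ⟨⟨0, by omega⟩⟩
  have hH := (pathGraph n)ᶜ.dAlphaMatrix_isHermitian α
  rcases h1.lt_or_eq with h1 | rfl
  · have hentry : ∀ i j, 0 ≤ (pathGraph n)ᶜ.dAlphaMatrix α i j := by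
      intro i j
      have : 0 ≤ 1 - α := by linarith
      simp only [dAlphaMatrix, transmissionMatrix, distMatrix, Matrix.add_apply,
        Matrix.smul_apply, of_apply,
        smul_eq_mul, diagonal_apply, transmission]
      split_ifs <;> positivity
    obtain ⟨v, hv, hv0, hev⟩ := hH.exists_nonneg_eigenvector hentry
    set t := ((pathGraph n)ᶜ.dAlphaMatrix α).largestEigenvalue
    set x : Fin n → ℝ := fun i => v i + v i.rev with hxdef
    have hx : ∀ i, 0 ≤ x i := fun i => add_nonneg (hv i) (hv _)
    have hxev : (pathGraph n)ᶜ.dAlphaMatrix α *ᵥ x = t • x := by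
      have h2 : x = v + fun i => v i.rev := rfl
      rw [h2, mulVec_add, hev]
      ext i
      rw [Pi.add_apply, pathGraph_compl_dAlphaMatrix_mulVec_rev hn, hev]
      simp [mul_add]
    set X : ℕ → ℝ := fun k => if h : k < n then x ⟨k, h⟩ else 0 with hX
    have hXx : (fun i : Fin n => X i) = x := by
      ext i; simp [hX]
    have hX0 : ∀ k < n, 0 ≤ X k := fun k hk => by simp [hX, hk, hx]
    have hsymm : ∀ k < n, X (n - 1 - k) = X k := by
      intro k hk
      have h2 : (⟨k, hk⟩ : Fin n).rev = ⟨n - 1 - k, by omega⟩ := by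
        ext; simp; omega
      have h3 : n - 1 - k < n := by omega
      simp only [hX, hk, h3, dif_pos, hxdef]
      rw [← h2, Fin.rev_rev, add_comm]
    refine ⟨X, t, le_rfl, by rw [hXx]; exact hxev, hX0, hsymm, fun k hk => ?_, ?_⟩
    · refine le_succ_of_concave_of_symm hsymm (fun k hk0 hk => ?_) hk
      have h2 := pathGraph_eigenvector_concave hn h1 hx hxev ⟨k, by omega⟩ hk0 hk
      simpa [hX, hk, show k - 1 < n by omega, show k < n by omega] using h2
    · intro i k hi0 hi hk
      have hXk : 0 < X k := by
        refine (hX0 k hk).lt_of_ne fun h => hv0 ?_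
        -- a zero entry forces the sum of all entries to vanish
        have hxk : x ⟨k, hk⟩ = 0 := by simpa [hX, hk] using h.symm
        have h2 := pathGraph_compl_dAlphaMatrix_mulVec hn α x ⟨k, hk⟩
        rw [hxev, Pi.smul_apply, hxk, smul_zero, mul_zero, zero_add, sub_zero] at h2
        have h3 : ∑ j, x j + pathNbrSum x ⟨k, hk⟩ = 0 :=
          (mul_eq_zero.1 h2.symm).resolve_left (by linarith)
        have h4 := pathNbrSum_nonneg hx ⟨k, hk⟩
        have h5 : ∑ j, x j = 0 :=
          le_antisymm (by linarith) (Finset.sum_nonneg fun j _ => hx j)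
        ext i
        have h6 := (Finset.sum_eq_zero_iff_of_nonneg fun j _ => hx j).1 h5 i (Finset.mem_univ i)
        have h7 := hv i
        have h8 := hv i.rev
        simp only [hxdef] at h6
        show v i = 0
        linarith
      have := mul_nonneg h0 (hX0 i (by omega))
      have := mul_pos (show 0 < 1 - α by linarith) hXk
      linarith
  · -- here `D_α` is the diagonal matrix of transmissions, at most `n + 1`
    refine ⟨fun k => if k = 0 ∨ k + 1 = n then 0 else 1, n + 1, ?_, ?_, ?_, ?_, ?_, ?_⟩
    · obtain ⟨v, hv⟩ := hH.isGreatest_largestEigenvalue.1.exists_hasEigenvector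
      obtain ⟨i, hi⟩ := Function.ne_iff.1 hv.2
      have h2 := congrFun hv.apply_eq_smul i
      rw [Matrix.toLin'_apply, pathGraph_compl_dAlphaMatrix_mulVec hn, Pi.smul_apply, smul_eq_mul,
        sub_self, zero_mul, add_zero, one_mul] at h2
      rw [dAlphaSpectralRadius, ← mul_right_cancel₀ hi h2]
      have := pathNbrSum_one_le_two i
      linarith
    · ext i
      rw [pathGraph_compl_dAlphaMatrix_mulVec hn, Pi.smul_apply, smul_eq_mul]
      by_cases h : (i : ℕ) = 0 ∨ (i : ℕ) + 1 = n
      · simp [h]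
      · rw [pathNbrSum, dif_pos (by omega), if_pos (by omega)]
        simp only [h, if_false]; ring
    · intro k _; dsimp only; split_ifs <;> norm_num
    · intro k hk; exact if_congr (by omega) rfl rfl
    · intro k hk
      dsimp only
      rw [if_neg (show ¬ (k + 1 = 0 ∨ k + 1 + 1 = n) by omega)]
      split_ifs <;> norm_num
    · intro i k hi0 hi _
      dsimp only
      rw [if_neg (by omega)]; norm_num


/-! ### Comparison of trees with the path -/

/-- The position in the path of the vertex numbered `k`, when the vertices of the path are numbered
from the middle outwards, alternating between the two sides. -/
def zigzag (n : ℕ) (k : Fin n) : Fin n :=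
  ⟨if (n - 1 - k) % 2 = 0 then (n - 1 - k) / 2 else n - 1 - (n - 1 - k) / 2, by
    split_ifs <;> omega⟩

theorem zigzag_bijective (n : ℕ) : Function.Bijective (zigzag n) := by
  rw [← Finite.injective_iff_bijective]
  intro i j h
  simp only [zigzag, Fin.mk.injEq] at h
  ext
  split_ifs at h <;> omega

theorem pathGraph_adj_zigzag {n : ℕ} (i j : Fin n) :
    (zigzag n i : ℕ) + 1 = zigzag n j ∨ (zigzag n j : ℕ) + 1 = zigzag n i ↔
      ((i : ℕ) ≠ 0 ∧ (j : ℕ) = i - 2) ∨ ((j : ℕ) ≠ 0 ∧ (i : ℕ) = j - 2) := by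
  simp only [zigzag]
  split_ifs <;> omega

/-- Summing a symmetric function over the adjacent pairs of a rooted forest on `Fin n`, given by a
parent function `q`. -/
theorem sum_sum_parent {n : ℕ} {F : Fin n → Fin n → ℝ} (hF : ∀ i j, F i j = F j i)
    {q : Fin n → Fin n} (hq : ∀ i : Fin n, (i : ℕ) ≠ 0 → q i < i) :
    ∑ i : Fin n, ∑ j : Fin n, (if ((i : ℕ) ≠ 0 ∧ j = q i) ∨ ((j : ℕ) ≠ 0 ∧ i = q j) then F i j else 0)
      = 2 * ∑ i : Fin n, if (i : ℕ) ≠ 0 then F i (q i) else 0 := by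
  have h1 : ∀ i j : Fin n,
      (if ((i : ℕ) ≠ 0 ∧ j = q i) ∨ ((j : ℕ) ≠ 0 ∧ i = q j) then F i j else 0)
      = (if j = q i then (if (i : ℕ) ≠ 0 then F i j else 0) else 0)
        + (if i = q j then (if (j : ℕ) ≠ 0 then F j i else 0) else 0) := by
    intro i j
    rw [hF j i]
    by_cases h1 : (i : ℕ) ≠ 0 ∧ j = q i
    · have h2 : ¬ ((j : ℕ) ≠ 0 ∧ i = q j) := fun h =>
        lt_asymm (h1.2 ▸ hq i h1.1) (h.2 ▸ hq j h.1)
      rw [if_pos (Or.inl h1), if_pos h1.2, if_pos h1.1]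
      by_cases h3 : i = q j
      · rw [if_pos h3, if_neg (fun h => h2 ⟨h, h3⟩), add_zero]
      · rw [if_neg h3, add_zero]
    · by_cases h2 : (j : ℕ) ≠ 0 ∧ i = q j
      · rw [if_pos (Or.inr h2), if_pos h2.2, if_pos h2.1]
        by_cases h3 : j = q i
        · rw [if_pos h3, if_neg (fun h => h1 ⟨h, h3⟩), zero_add]
        · rw [if_neg h3, zero_add]
      · rw [if_neg (by tauto), ← ite_and, ← ite_and, if_neg (by tauto), if_neg (by tauto),
          add_zero]
  simp only [h1, Finset.sum_add_distrib]
  rw [two_mul]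
  congr 1
  · simp
  · rw [Finset.sum_comm]; simp

/-- Among the trees numbered so that each `k ≠ 0` has its parent at most `k - 2`, the zigzag path,
whose parents are exactly `k - 2`, has the least sum of edge weights of a decreasing sequence. -/
theorem sum_zigzag_le {n : ℕ} {G : SimpleGraph (Fin n)} [DecidableRel G.Adj] {p : Fin n → Fin n}
    (hp : ∀ i : Fin n, (i : ℕ) ≠ 0 → (p i : ℕ) ≤ i - 2)
    (hpG : ∀ i : Fin n, (i : ℕ) ≠ 0 → G.Adj i (p i))
    {α : ℝ} (h0 : 0 ≤ α) (h1 : α ≤ 1) {y : Fin n → ℝ} (hy : ∀ i, 0 ≤ y i) (hanti : Antitone y) :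
    ∑ i : Fin n, ∑ j : Fin n, (if ((i : ℕ) ≠ 0 ∧ (j : ℕ) = i - 2) ∨ ((j : ℕ) ≠ 0 ∧ (i : ℕ) = j - 2)
        then pairWeight α (y i) (y j) else 0)
      ≤ ∑ i, ∑ j, if G.Adj i j then pairWeight α (y i) (y j) else 0 := by
  have hsymm : ∀ i j, pairWeight α (y i) (y j) = pairWeight α (y j) (y i) := fun i j => by
    unfold pairWeight; ring
  have hZ := sum_sum_parent hsymm (q := fun i : Fin n => ⟨i - 2, by omega⟩)
    fun i hi => Fin.lt_def.2 (show (i : ℕ) - 2 < i by omega)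
  have hP := sum_sum_parent hsymm (q := p) fun i hi =>
    Fin.lt_def.2 ((hp i hi).trans_lt (by omega))
  simp only [Fin.ext_iff] at hZ
  rw [hZ]
  calc _ ≤ 2 * ∑ i : Fin n, (if (i : ℕ) ≠ 0 then pairWeight α (y i) (y (p i)) else 0) := by
        refine mul_le_mul_of_nonneg_left (Finset.sum_le_sum fun i _ => ?_) zero_le_two
        split_ifs with hi
        · exact pairWeight_le_pairWeight h0 h1 (hy _) (hy _) (hanti (Fin.le_def.2 (hp i hi)))
        · exact le_rfl
    _ = _ := hP.symm
    _ ≤ _ := by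
        refine Finset.sum_le_sum fun i _ => Finset.sum_le_sum fun j _ => ?_
        by_cases h : ((i : ℕ) ≠ 0 ∧ j = p i) ∨ ((j : ℕ) ≠ 0 ∧ i = p j)
        · have hadj : G.Adj i j := by
            rcases h with ⟨hi, rfl⟩ | ⟨hj, rfl⟩
            · exact hpG i hi
            · exact (hpG j hj).symm
          rw [if_pos h, if_pos hadj]
        · rw [if_neg h]
          split_ifs
          · exact pairWeight_nonneg h0 h1 (hy _) (hy _)
          · exact le_rfl

/-- A tree whose vertices can be numbered so that each `k ≠ 0` is adjacent to `k - 2` is a path. -/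
theorem IsTree.nonempty_iso_pathGraph {n : ℕ} {V : Type*} {T : SimpleGraph V} (hT : T.IsTree)
    (e : Fin n ≃ V) (h : ∀ i j : Fin n, (i : ℕ) ≠ 0 → (j : ℕ) = i - 2 → T.Adj (e i) (e j)) :
    Nonempty (T ≃g pathGraph n) := by
  set f : Fin n ≃ V := (Equiv.ofBijective _ (zigzag_bijective n)).symm.trans e with hf
  have hfz : ∀ i, f (zigzag n i) = e i := fun i => by
    rw [hf, Equiv.trans_apply]
    congr 1
    exact Equiv.ofBijective_symm_apply_apply _ (zigzag_bijective n) i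
  have hle : pathGraph n ≤ T.comap f := by
    intro a b hab
    obtain ⟨i, rfl⟩ := (zigzag_bijective n).2 a
    obtain ⟨j, rfl⟩ := (zigzag_bijective n).2 b
    rw [pathGraph_adj, pathGraph_adj_zigzag] at hab
    rw [comap_adj, hfz, hfz]
    rcases hab with ⟨hi, hj⟩ | ⟨hj, hi⟩
    · exact h i j hi hj
    · exact (h j i hj hi).symm
  have hiso : T.comap f ≃g T := Iso.comap f T
  have hmin := isTree_iff_minimal_connected.1 (hiso.isTree_iff.2 hT)
  have : Nonempty V := hT.connected.nonempty
  have : Nonempty (Fin n) := f.nonempty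
  have hconn : (pathGraph n).Connected := ⟨pathGraph_preconnected n⟩
  have heq : pathGraph n = T.comap f := le_antisymm hle (hmin.2 hconn hle)
  rw [heq]
  exact ⟨hiso.symm⟩

/-- The comparison for a tree numbered as in `IsTree.exists_numbering`, in which `k₀` is the first
vertex whose parent `j₀` is less than `k₀ - 2`. -/
theorem dAlphaSpectralRadius_pathGraph_compl_lt {V : Type*} [Fintype V] [DecidableEq V] {n : ℕ}
    (hn : 5 ≤ n) {T : SimpleGraph V} (hconn : Tᶜ.Connected) (e : Fin n ≃ V) {p : Fin n → Fin n}
    (hp : ∀ i : Fin n, (i : ℕ) ≠ 0 → (p i : ℕ) ≤ i - 2)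
    (hpT : ∀ i : Fin n, (i : ℕ) ≠ 0 → T.Adj (e i) (e (p i)))
    {j₀ k₀ : Fin n} (hjk : (j₀ : ℕ) < k₀ - 2) (hadj : T.Adj (e k₀) (e j₀))
    (hmin : ∀ i j : Fin n, i < k₀ → (i : ℕ) ≠ 0 → (j : ℕ) = i - 2 → T.Adj (e i) (e j))
    {α : ℝ} (h0 : 0 ≤ α) (h1 : α ≤ 1) :
    (pathGraph n)ᶜ.dAlphaSpectralRadius α < Tᶜ.dAlphaSpectralRadius α := by
  classical
  obtain ⟨X, t, ht, hev, hX0, hsymm, hmono, hpos⟩ := exists_pathGraph_profile hn h0 h1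
  set P := (pathGraph n)ᶜ
  set x : Fin n → ℝ := fun i => X i with hx
  let y : Fin n → ℝ := fun k => X ((n - 1 - k) / 2)
  have hxy : ∀ k, x (zigzag n k) = y k := by
    intro k
    simp only [hx, y, zigzag]
    split_ifs
    · rfl
    · exact hsymm _ (by omega)
  have hy : ∀ k, 0 ≤ y k := fun k => hX0 _ (by omega)
  have hanti : Antitone y := by
    intro i j hij
    have hmono' : ∀ d a, 2 * (a + d) ≤ n → X a ≤ X (a + d) := by
      intro d
      induction d with
      | zero => intro a _; exact le_rfl
      | succ d ih => intro a ha; exact (ih a (by omega)).trans (hmono (a + d) (by omega))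
    have hij' : (i : ℕ) ≤ j := hij
    have h2 := hmono' ((n - 1 - i) / 2 - (n - 1 - j) / 2) ((n - 1 - j) / 2) (by omega)
    rwa [Nat.add_sub_cancel' (by omega)] at h2
  let z : V → ℝ := fun v => y (e.symm v)
  have hz : ∀ k, z (e k) = y k := fun k => by simp [z]
  have hP : ∀ i j, (P.dist (zigzag n i) (zigzag n j) : ℝ) = (if i = j then 0 else 1) +
      (if ((i : ℕ) ≠ 0 ∧ (j : ℕ) = i - 2) ∨ ((j : ℕ) ≠ 0 ∧ (i : ℕ) = j - 2) then 1 else 0) := by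
    intro i j
    rw [pathGraph_compl_dist hn]
    simp only [pathGraph_adj_zigzag, (zigzag_bijective n).1.eq_iff]
    push_cast; rfl
  have hT : ∀ i j, (if i = j then 0 else 1) + (if T.Adj (e i) (e j) then 1 else 0)
      ≤ (Tᶜ.dist (e i) (e j) : ℝ) := by
    intro i j
    have := le_compl_dist hconn (e i) (e j)
    simp only [e.injective.eq_iff] at this
    exact_mod_cast this
  have sumP : ∀ f : Fin n → ℝ, ∑ i, f (zigzag n i) = ∑ i, f i :=
    (zigzag_bijective n).sum_comp
  have hnorm : z ⬝ᵥ z = x ⬝ᵥ x := by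
    simp only [dotProduct]
    rw [← e.sum_comp, ← sumP fun i => x i * x i]
    simp only [hz, hxy]
  have hform : x ⬝ᵥ (P.dAlphaMatrix α *ᵥ x) ≤ z ⬝ᵥ (Tᶜ.dAlphaMatrix α *ᵥ z) := by
    rw [dotProduct_dAlphaMatrix_mulVec, dotProduct_dAlphaMatrix_mulVec, ← e.sum_comp, ← sumP]
    simp only [← e.sum_comp (fun v => _ * pairWeight α _ (z v)),
      ← sumP (fun v => _ * pairWeight α _ (x v)), hz, hxy, hP]
    have hw := fun i j => pairWeight_nonneg h0 h1 (hy i) (hy j)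
    calc _ = ∑ i, ∑ j, (if i = j then 0 else 1) * pairWeight α (y i) (y j)
          + ∑ i : Fin n, ∑ j : Fin n, (if ((i : ℕ) ≠ 0 ∧ (j : ℕ) = i - 2) ∨ ((j : ℕ) ≠ 0 ∧ (i : ℕ) = j - 2)
              then pairWeight α (y i) (y j) else 0) := by
          simp only [add_mul, Finset.sum_add_distrib, ite_mul, one_mul, zero_mul]
      _ ≤ ∑ i, ∑ j, (if i = j then 0 else 1) * pairWeight α (y i) (y j)
          + ∑ i, ∑ j, (if (T.comap e).Adj i j then pairWeight α (y i) (y j) else 0) :=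
          add_le_add_right (sum_zigzag_le hp hpT h0 h1 hy hanti) _
      _ = ∑ i, ∑ j, ((if i = j then 0 else 1) + (if T.Adj (e i) (e j) then 1 else 0))
            * pairWeight α (y i) (y j) := by
          simp only [add_mul, Finset.sum_add_distrib, ite_mul, one_mul, zero_mul, comap_adj]
      _ ≤ _ := Finset.sum_le_sum fun i _ => Finset.sum_le_sum fun j _ =>
          mul_le_mul_of_nonneg_right (hT i j) (hw i j)
  refine ht.trans_lt (lt_of_not_ge fun hle => ?_)
  have heq := (Tᶜ.dAlphaMatrix_isHermitian α).mulVec_eq_of_largestEigenvalue_le hle (x := z) (by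
    rw [hnorm, ← smul_eq_mul, ← dotProduct_smul, ← hev]; exact hform)
  -- at `j₀` the tree has all the neighbours of the path, and `k₀` in addition
  have hrowT := congrFun heq (e j₀)
  have hrowP := congrFun hev (zigzag n j₀)
  rw [dAlphaMatrix_mulVec, ← e.sum_comp, Pi.smul_apply] at hrowT
  rw [dAlphaMatrix_mulVec, ← sumP, Pi.smul_apply] at hrowP
  simp only [hz] at hrowT
  simp only [hxy] at hrowP
  refine absurd (hrowP.trans hrowT.symm) (ne_of_lt ?_)
  have hw : ∀ k, 0 ≤ α * y j₀ + (1 - α) * y k := fun k =>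
    add_nonneg (mul_nonneg h0 (hy _)) (mul_nonneg (by linarith) (hy _))
  have hj₀ : (j₀ : ℕ) + 4 ≤ n := by omega
  refine Finset.sum_lt_sum (fun k _ => mul_le_mul_of_nonneg_right ?_ (hw k))
    ⟨k₀, Finset.mem_univ _, mul_lt_mul_of_pos_right ?_ ?_⟩
  · refine le_trans ?_ (hT j₀ k)
    rw [hP]
    refine add_le_add_right ?_ _
    by_cases h : ((j₀ : ℕ) ≠ 0 ∧ (k : ℕ) = j₀ - 2) ∨ ((k : ℕ) ≠ 0 ∧ (j₀ : ℕ) = k - 2)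
    · have hadj' : T.Adj (e j₀) (e k) := by
        rcases h with ⟨h2, h3⟩ | ⟨h2, h3⟩
        · exact hmin _ _ (Fin.lt_def.2 (by omega)) h2 h3
        · exact (hmin _ _ (Fin.lt_def.2 (by omega)) h2 h3).symm
      rw [if_pos h, if_pos hadj']
    · rw [if_neg h]; split_ifs <;> norm_num
  · refine lt_of_lt_of_le ?_ (hT j₀ k₀)
    rw [hP, if_pos hadj.symm, if_neg (by omega : ¬ (((j₀ : ℕ) ≠ 0 ∧ (k₀ : ℕ) = j₀ - 2) ∨
      ((k₀ : ℕ) ≠ 0 ∧ (j₀ : ℕ) = k₀ - 2)))]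
    linarith
  · exact hpos _ _ (by omega) (by omega) (by omega)

end SimpleGraph

theorem mainTheorem4 {V : Type*} [Fintype V] [DecidableEq V] (n : ℕ) (hn : 4 ≤ n)
    (hV : Fintype.card V = n) (T : SimpleGraph V) (hT : T.IsTree)
    (hstar : IsEmpty (T ≃g completeBipartiteGraph (Fin 1) (Fin (n - 1))))
    (hpath : IsEmpty (T ≃g SimpleGraph.pathGraph n)) :
    (SimpleGraph.pathGraph n)ᶜ.distSpectralRadius < Tᶜ.distSpectralRadius ∧
    (SimpleGraph.pathGraph n)ᶜ.distSignlessLapSpectralRadius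
      < Tᶜ.distSignlessLapSpectralRadius ∧
    ∀ α : ℝ, 0 ≤ α → α ≤ 1 →
      (SimpleGraph.pathGraph n)ᶜ.dAlphaSpectralRadius α < Tᶜ.dAlphaSpectralRadius α := by
  have hne : Nonempty V := hT.connected.nonempty
  have hne' : Nonempty (Fin n) := ⟨⟨0, by omega⟩⟩
  have hdom : ∀ c, ∃ w, w ≠ c ∧ ¬ T.Adj c w := by
    intro c
    by_contra! h
    obtain ⟨f⟩ := hT.isAcyclic.nonempty_iso_star hV h
    exact hstar.false f
  have hconn := hT.isAcyclic.connected_compl hdom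
  obtain ⟨ℓ, hsurj, hpar⟩ := hT.exists_numbering n hV
  have hbij : Function.Bijective fun k : Fin n => ℓ k := by
    rw [Fintype.bijective_iff_surjective_and_card, Fintype.card_fin, hV]
    refine ⟨fun v => ?_, rfl⟩
    obtain ⟨k, hk, hkv⟩ := hsurj v
    exact ⟨⟨k, hk⟩, hkv⟩
  let e : Fin n ≃ V := Equiv.ofBijective _ hbij
  have hpar' : ∀ i : Fin n, ∃ j : Fin n, (i : ℕ) ≠ 0 → (j : ℕ) ≤ i - 2 ∧ T.Adj (e i) (e j) := by
    intro i
    by_cases hi : (i : ℕ) = 0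
    · exact ⟨i, fun h => absurd hi h⟩
    · obtain ⟨j, hj, hadj⟩ := hpar i (by omega) i.2
      exact ⟨⟨j, by omega⟩, fun _ => ⟨hj, hadj⟩⟩
  choose p hp using hpar'
  have hbad : ∃ k, ∃ h : k < n, k ≠ 0 ∧ ¬ T.Adj (e ⟨k, h⟩) (e ⟨k - 2, by omega⟩) := by
    by_contra! h
    obtain ⟨f⟩ := hT.nonempty_iso_pathGraph e fun i j hi hj => by
      have : j = ⟨i - 2, by omega⟩ := Fin.ext hj
      rw [this]
      exact h i i.2 hi
    exact hpath.false f
  classical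
  obtain ⟨hk, hk0, hkadj⟩ := Nat.find_spec hbad
  have hmin := fun m => Nat.find_min hbad (m := m)
  set k := Nat.find hbad
  have hmin' : ∀ i j : Fin n, i < ⟨k, hk⟩ → (i : ℕ) ≠ 0 → (j : ℕ) = i - 2 →
      T.Adj (e i) (e j) := by
    intro i j hik hi hj
    have h := hmin i hik
    push Not at h
    have : j = ⟨i - 2, by omega⟩ := Fin.ext hj
    rw [this]
    exact h i.2 hi
  obtain ⟨hpk, hpadj⟩ := hp ⟨k, hk⟩ hk0
  have hlt : (p ⟨k, hk⟩ : ℕ) < k - 2 := by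
    refine lt_of_le_of_ne hpk fun h => hkadj ?_
    have : p ⟨k, hk⟩ = ⟨k - 2, by omega⟩ := Fin.ext h
    rwa [this] at hpadj
  have hn5 : 5 ≤ n := by
    by_contra h
    -- on four vertices, `0` would be adjacent to `1`, `2` and `3`
    have hk3 : k = 3 := by omega
    have hroot : ∀ i : Fin n, (i : ℕ) ≠ 0 → T.Adj (e ⟨0, by omega⟩) (e i) := by
      intro i hi
      have h2 : p i = ⟨0, by omega⟩ := by
        ext
        by_cases hi3 : i = ⟨k, hk⟩
        · rw [hi3]; simp only; omega
        · have := (hp i hi).1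
          have : (i : ℕ) ≠ k := fun h => hi3 (Fin.ext h)
          simp only; omega
      exact h2 ▸ (hp i hi).2.symm
    obtain ⟨w, hw, hw'⟩ := hdom (e ⟨0, by omega⟩)
    obtain ⟨i, rfl⟩ := e.surjective w
    exact hw' (hroot i fun h => hw (congrArg e (Fin.ext h)))
  have key : ∀ α : ℝ, 0 ≤ α → α ≤ 1 →
      (pathGraph n)ᶜ.dAlphaSpectralRadius α < Tᶜ.dAlphaSpectralRadius α := fun α h0 h1 =>
    dAlphaSpectralRadius_pathGraph_compl_lt hn5 hconn e (fun i hi => (hp i hi).1)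
      (fun i hi => (hp i hi).2) hlt hpadj hmin' h0 h1
  refine ⟨?_, ?_, key⟩
  · rw [distSpectralRadius_eq_dAlphaSpectralRadius, distSpectralRadius_eq_dAlphaSpectralRadius]
    exact key 0 le_rfl zero_le_one
  · rw [distSignlessLapSpectralRadius_eq, distSignlessLapSpectralRadius_eq]
    have := key (1 / 2) (by norm_num) (by norm_num)
    linarith
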